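/- For a sequence $t=(t_n)_{n\ge 1}$ with letters in $\{1,2\}$, define finite words $w_0,w_1,w_2,\dots$ recursively: $w_0$ is the empty word and, for $n\ge 1$, $w_n=w_{n-1}\,t_n^{\ell_n}$, where $\ell_n$ is the $n$-th letter of the word $w_{n-1}t_n$ (which has length at least $n$). Each $w_n$ has length at least $n$ and is a prefix of $w_{n+1}$; the sequence $\mathcal{O}_t=(x_n)_{n\ge1}$ directed by $t$ is the limit of the words $w_n$. In other words, the $n$-th block of $\mathcal{O}_t$ has length $x_n$ and is filled with the letter $t_n$. Let $p\in\,]0,1[$ and let $\mathbb{T}=(T_n)_{n\ge 1}$ be a Markov chain over the alphabet $\{1,2\}$ with initial value $T_1=1$ and whose transition probability from $1$ to $2$, and from $2$ to $1$, is $p$. Let $\mathbb{X}=(X_n)_{n\ge1}=\mathcal{O}_{\mathbb{T}}$ be the random sequence directed by $\mathbb{T}$, and let $|X_1\dots X_n|_1$ denote the number of indices $i\in\{1,\dots,n\}$ with $X_i=1$. Then $$\lim_{n\to\infty}\frac{\mathbb{E}\big(|X_1\dots X_n|_1\big)}{n}=\frac12 .$$ -/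

import Mathlib

open MeasureTheory ProbabilityTheory Filter Topology

/-! Sequences indexed by the positive integers are represented by functions on `ℕ`, shifted by one:
`t 0, t 1, t 2, …` are the letters `t₁, t₂, t₃, …`. -/

/-- The finite word `w_n = O_{t₁…t_n}` written after `n` steps: at each step one appends the next
letter of `t` as a block whose length is the letter of the word itself whose position is the number
of the block (that letter is possibly the one just written). -/
def directedWord (t : ℕ → ℕ) : ℕ → List ℕ
  | 0 => []
  | n + 1 =>
    (directedWord t n ++ [t n]) ++
      List.replicate ((directedWord t n ++ [t n]).getD n 0 - 1) (t n)

/-- The infinite sequence `O_t` directed by `t`, the limit of the words `directedWord t n`: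
its letter with index `m` is read off the word `directedWord t (m + 1)`, which is long enough
(`le_length_directedWord`); any other long enough word gives the same letter
(`directedWord_getElem?`). -/
def directedSeq (t : ℕ → ℕ) (m : ℕ) : ℕ :=
  (directedWord t (m + 1)).getD m 0

theorem le_length_directedWord (t : ℕ → ℕ) (n : ℕ) : n ≤ (directedWord t n).length := by
  induction n with
  | zero => exact Nat.zero_le _
  | succ n ih =>
    simp only [directedWord, List.length_append, List.length_replicate, List.length_singleton]
    omega

theorem directedWord_prefix (t : ℕ → ℕ) {m n : ℕ} (h : m ≤ n) :
    directedWord t m <+: directedWord t n := by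
  induction n, h using Nat.le_induction with
  | base => exact List.prefix_refl _
  | succ n _ ih =>
    refine ih.trans ?_
    simp only [directedWord, List.append_assoc]
    exact List.prefix_append _ _

/-- `directedSeq t` is the limit of the words `directedWord t n`: each of them is a prefix of it. -/
theorem directedWord_getElem? (t : ℕ → ℕ) (n m : ℕ) (h : m < (directedWord t n).length) :
    (directedWord t n)[m]? = some (directedSeq t m) := by
  have h1 : m < (directedWord t (m + 1)).length := le_length_directedWord t (m + 1)
  have key : (directedWord t n)[m]? = (directedWord t (m + 1))[m]? := by
    rcases le_total n (m + 1) with hn | hn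
    · have := (directedWord_prefix t hn).getElem h
      rw [List.getElem?_eq_getElem h, List.getElem?_eq_getElem h1, this]
    · have := (directedWord_prefix t hn).getElem h1
      rw [List.getElem?_eq_getElem h, List.getElem?_eq_getElem h1, this]
  rw [key, directedSeq, List.getD_eq_getElem?_getD, List.getElem?_eq_getElem h1]
  rfl

/-- `|x₁ … x_n|_a`, the number of occurrences of the letter `a` among the first `n` letters
of the sequence `x`. -/
def letterCount (a : ℕ) (x : ℕ → ℕ) (n : ℕ) : ℕ :=
  ((Finset.range n).filter (fun i => x i = a)).card

/-- Under the probability measure `P`, the process `T` is a (time-homogeneous) Markov chain over the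
alphabet `A`, with initial value `x₀` and transition probabilities `Q`: conditionally on any past
trajectory `a 0, …, a n` of positive probability, the next letter is `b` with probability
`Q (a n) b`. -/
structure IsMarkovChain {Ω : Type*} [MeasurableSpace Ω] (P : Measure Ω) (A : Set ℕ) (x₀ : ℕ)
    (Q : ℕ → ℕ → ℝ) (T : ℕ → Ω → ℕ) : Prop where
  measurable : ∀ n, Measurable (T n)
  mem_alphabet : ∀ n ω, T n ω ∈ A
  initial : ∀ᵐ ω ∂P, T 0 ω = x₀
  transition : ∀ (n : ℕ) (a : ℕ → ℕ) (b : ℕ), b ∈ A →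
    P {ω | ∀ i ≤ n, T i ω = a i} ≠ 0 →
    (P[|{ω | ∀ i ≤ n, T i ω = a i}]).real {ω | T (n + 1) ω = b} = Q (a n) b

/-- The transition probabilities on a two-letter alphabet for which the letter changes with
probability `p` and stays the same with probability `1 - p`. -/
def flipTransition (p : ℝ) (a b : ℕ) : ℝ := if a = b then 1 - p else p

/-! Give the letter 1 the sign +1 and the letter 2 the sign -1; the claim becomes that the expected
signed count of the first `n` letters is `o(n)`. Up to a bounded error this count is the sum, over
blocks starting before position `n`, of block length times the sign of the directing letter.

The length of block `m + L` is the letter at position `m + L`. It is usually already written in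
`directedWord t m`, hence determined by directing letters `L` steps or more in the past, whose
correlation with the sign of `T (m + L)` is of order `|1 - 2p|^L` (`integral_letterSign_add_mul`).
This fails only when the word after `m` steps has length at most `m + L`. Almost surely 2 occurs
infinitely often, each 2 in the sequence makes some block gain a letter, and so the probability of
failure tends to 0 (`tendsto_integral_length_le`).

Altogether (`abs_integral_signSum_le`) the expectation is at most a constant depending on `L`, plus
`o(n)`, plus `2n|1 - 2p|^L`. Divide by `n`, let `n` grow, then choose `L` large. -/

/-! ### Deterministic properties of directed sequences -/

/-- The sign of a letter: `1` for the letter `1` and `-1` for the letter `2`. -/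
def letterSign (v : ℕ) : ℝ := 3 - 2 * v

theorem abs_letterSign {v : ℕ} (hv : v = 1 ∨ v = 2) : |letterSign v| = 1 := by
  rcases hv with rfl | rfl <;> norm_num [letterSign]

theorem getD_directedWord (t : ℕ → ℕ) {n m : ℕ} (h : m < (directedWord t n).length) :
    (directedWord t n).getD m 0 = directedSeq t m := by
  rw [List.getD_eq_getElem?_getD, directedWord_getElem? t n m h, Option.getD_some]

theorem mem_directedWord {t : ℕ → ℕ} {v n : ℕ} (h : v ∈ directedWord t n) : ∃ i < n, v = t i := by
  induction n with
  | zero => simp [directedWord] at h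
  | succ n ih =>
    simp only [directedWord, List.mem_append, List.mem_singleton, List.mem_replicate] at h
    rcases h with (h | h) | ⟨-, h⟩
    · obtain ⟨i, hi, rfl⟩ := ih h
      exact ⟨i, by omega, rfl⟩
    · exact ⟨n, by omega, h⟩
    · exact ⟨n, by omega, h⟩

theorem directedSeq_mem {t : ℕ → ℕ} (ht : ∀ i, t i = 1 ∨ t i = 2) (m : ℕ) :
    directedSeq t m = 1 ∨ directedSeq t m = 2 := by
  have h := le_length_directedWord t (m + 1)
  obtain ⟨i, -, hi⟩ := mem_directedWord
    (List.mem_of_getElem? (directedWord_getElem? t (m + 1) m h))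
  rw [hi]
  exact ht i

theorem directedWord_succ {t : ℕ → ℕ} (ht : ∀ i, t i = 1 ∨ t i = 2) (n : ℕ) :
    directedWord t (n + 1) = directedWord t n ++ List.replicate (directedSeq t n) (t n) := by
  have hl : n < (directedWord t n ++ [t n]).length := by
    have := le_length_directedWord t n
    simp only [List.length_append, List.length_singleton]
    omega
  have hx : (directedWord t n ++ [t n]).getD n 0 = directedSeq t n := by
    rw [directedSeq, directedWord, List.getD_append _ _ _ _ hl]
  rw [directedWord, hx, List.append_assoc]
  -- The truncated `- 1` in the definition is harmless because block lengths are at least 1.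
  rcases directedSeq_mem ht n with h | h <;> simp [h, List.replicate]

theorem length_directedWord_succ {t : ℕ → ℕ} (ht : ∀ i, t i = 1 ∨ t i = 2) (n : ℕ) :
    (directedWord t (n + 1)).length = (directedWord t n).length + directedSeq t n := by
  rw [directedWord_succ ht, List.length_append, List.length_replicate]

theorem length_directedWord_mono (t : ℕ → ℕ) : Monotone fun n => (directedWord t n).length :=
  fun _ _ h => (directedWord_prefix t h).length_le

theorem directedSeq_block {t : ℕ → ℕ} (ht : ∀ i, t i = 1 ∨ t i = 2) {n i : ℕ}
    (hi : i < directedSeq t n) : directedSeq t ((directedWord t n).length + i) = t n := by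
  have h : (directedWord t n).length + i < (directedWord t (n + 1)).length := by
    rw [length_directedWord_succ ht]; omega
  rw [← getD_directedWord t h, directedWord_succ ht, List.getD_append_right _ _ _ _ (by omega)]
  simp [hi]

/-- The signed letter count of the first `n` letters of a sequence. -/
def signSum (x : ℕ → ℕ) (n : ℕ) : ℝ := ∑ i ∈ Finset.range n, letterSign (x i)

theorem letterCount_one_eq {x : ℕ → ℕ} (hx : ∀ i, x i = 1 ∨ x i = 2) (n : ℕ) :
    (letterCount 1 x n : ℝ) = (n + signSum x n) / 2 := by
  rw [letterCount, Finset.card_filter, signSum]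
  induction n with
  | zero => simp
  | succ n ih =>
    rw [Finset.sum_range_succ, Finset.sum_range_succ, Nat.cast_add, ih]
    rcases hx n with h | h <;> norm_num [h, letterSign] <;> ring

theorem signSum_add (x : ℕ → ℕ) (m n : ℕ) :
    signSum x (m + n) = signSum x m + ∑ i ∈ Finset.range n, letterSign (x (m + i)) :=
  Finset.sum_range_add _ _ _

theorem abs_signSum_sub_le {x : ℕ → ℕ} (hx : ∀ i, x i = 1 ∨ x i = 2) (m n : ℕ) :
    |signSum x (m + n) - signSum x m| ≤ n := by
  rw [signSum_add, add_sub_cancel_left]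
  refine (Finset.abs_sum_le_sum_abs _ _).trans ?_
  simp [abs_letterSign (hx _)]

theorem signSum_length_succ {t : ℕ → ℕ} (ht : ∀ i, t i = 1 ∨ t i = 2) (n : ℕ) :
    signSum (directedSeq t) (directedWord t (n + 1)).length =
      signSum (directedSeq t) (directedWord t n).length + directedSeq t n * letterSign (t n) := by
  rw [length_directedWord_succ ht, signSum_add]
  congr 1
  rw [Finset.sum_congr rfl fun i hi => by rw [directedSeq_block ht (Finset.mem_range.1 hi)]]
  simp

/-- Summing over the blocks that start before position `n` gives the signed count up to `n`,
with an error of at most one letter. -/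
theorem abs_signSum_sub_blocks_le {t : ℕ → ℕ} (ht : ∀ i, t i = 1 ∨ t i = 2) {n k : ℕ}
    (hk : n ≤ k) :
    |signSum (directedSeq t) n - ∑ i ∈ Finset.range k, directedSeq t i * letterSign (t i) *
      (if (directedWord t i).length < n then 1 else 0)| ≤ 1 := by
  set f : ℕ → ℝ := fun i => directedSeq t i * letterSign (t i) *
      (if (directedWord t i).length < n then 1 else 0) with hf
  -- Invariant: the sum is exact while the blocks stop short of `n`; once they reach `n`, it no
  -- longer changes.
  have key : ∀ k, ((directedWord t k).length < n ∧
      ∑ i ∈ Finset.range k, f i = signSum (directedSeq t) (directedWord t k).length) ∨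
      (n ≤ (directedWord t k).length ∧
        |signSum (directedSeq t) n - ∑ i ∈ Finset.range k, f i| ≤ 1) := by
    intro k
    induction k with
    | zero =>
      rcases Nat.eq_zero_or_pos n with rfl | h
      · exact Or.inr ⟨le_rfl.trans (Nat.zero_le _), by simp [signSum]⟩
      · exact Or.inl ⟨by simpa [directedWord] using h, by simp [directedWord, signSum]⟩
    | succ k ih =>
      rw [Finset.sum_range_succ]
      rcases ih with ⟨h, hs⟩ | ⟨h, hs⟩
      · have e : ∑ i ∈ Finset.range k, f i + f k =
            signSum (directedSeq t) (directedWord t (k + 1)).length := by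
          rw [hs, signSum_length_succ ht, hf]
          simp [h]
        rw [e]
        rcases lt_or_ge (directedWord t (k + 1)).length n with h' | h'
        · exact Or.inl ⟨h', rfl⟩
        · refine Or.inr ⟨h', ?_⟩
          obtain ⟨d, hd⟩ := Nat.exists_eq_add_of_le h'
          -- A block of length at most 2 that starts before `n` overshoots `n` by at most one
          -- letter.
          have hd1 : d ≤ 1 := by
            have := length_directedWord_succ ht k
            rcases directedSeq_mem ht k with h2 | h2 <;> omega
          rw [hd, abs_sub_comm]
          exact (abs_signSum_sub_le (directedSeq_mem ht) n d).trans (by exact_mod_cast hd1)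
      · have e : f k = 0 := by simp [hf, not_lt.2 h]
        rw [e, add_zero]
        exact Or.inr ⟨h.trans (length_directedWord_mono t k.le_succ), hs⟩
  rcases key k with ⟨h, -⟩ | ⟨-, h⟩
  · exact absurd (hk.trans (le_length_directedWord t k)) (not_le.2 h)
  · exact h

/-! ### Predicting block lengths `L` blocks ahead -/

/-- The contribution of the block with index `m + L` to the signed count up to `n`, as predicted
from the word `directedWord t m` (apart from the letter of the block). -/
def predictedBlock (n L m : ℕ) (t : ℕ → ℕ) : ℝ :=
  (directedWord t m).getD (m + L) 0 * (if (directedWord t m).length < n then 1 else 0)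

theorem getD_directedWord_le {t : ℕ → ℕ} (ht : ∀ i, t i = 1 ∨ t i = 2) (n m : ℕ) :
    (directedWord t n).getD m 0 ≤ 2 := by
  rcases lt_or_ge m (directedWord t n).length with h | h
  · rw [getD_directedWord t h]
    rcases directedSeq_mem ht m with h | h <;> omega
  · rw [List.getD_eq_default _ _ h]
    omega

theorem abs_predictedBlock_le {t : ℕ → ℕ} (ht : ∀ i, t i = 1 ∨ t i = 2) (n L m : ℕ) :
    |predictedBlock n L m t| ≤ 2 := by
  have h : (((directedWord t m).getD (m + L) 0 : ℕ) : ℝ) ≤ 2 := by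
    exact_mod_cast getD_directedWord_le ht m (m + L)
  have h0 := Nat.cast_nonneg (α := ℝ) ((directedWord t m).getD (m + L) 0)
  rw [predictedBlock, abs_le]
  split_ifs <;> constructor <;> linarith

/-- Two sources of error: the letter at position `m + L` may not be written yet, and position `n`
may be reached between steps `m` and `m + L`. The second is kept as a difference of indicators so
that it telescopes over `m`. -/
theorem abs_block_sub_predictedBlock_le {t : ℕ → ℕ} (ht : ∀ i, t i = 1 ∨ t i = 2) (n L m : ℕ) :
    |directedSeq t (m + L) * letterSign (t (m + L)) *
        (if (directedWord t (m + L)).length < n then 1 else 0) -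
      letterSign (t (m + L)) * predictedBlock n L m t| ≤
      2 * (if (directedWord t m).length ≤ m + L then 1 else 0) +
      2 * ((if (directedWord t m).length < n then 1 else 0) -
        (if (directedWord t (m + L)).length < n then 1 else 0)) := by
  have hmono : (directedWord t m).length ≤ (directedWord t (m + L)).length :=
    length_directedWord_mono t (Nat.le_add_right m L)
  have hy : (((directedWord t m).getD (m + L) 0 : ℕ) : ℝ) ≤ 2 := by
    exact_mod_cast getD_directedWord_le ht m (m + L)
  have hy0 := Nat.cast_nonneg (α := ℝ) ((directedWord t m).getD (m + L) 0)
  have hx0 := Nat.cast_nonneg (α := ℝ) (directedSeq t (m + L))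
  have hx : (directedSeq t (m + L) : ℝ) ≤ 2 := by
    rcases directedSeq_mem ht (m + L) with h | h <;> norm_num [h]
  rw [predictedBlock, mul_right_comm, mul_comm (letterSign _), ← sub_mul, abs_mul,
    abs_letterSign (ht _), mul_one, abs_le]
  rcases lt_or_ge (m + L) (directedWord t m).length with h | h
  · rw [getD_directedWord t h, if_neg (not_le.2 h)]
    split_ifs <;> first | omega | (constructor <;> linarith)
  · rw [if_pos h]
    split_ifs <;> first | omega | (constructor <;> linarith)

/-- The signed count up to `n` differs from the sum of the predicted contributions by a bounded
amount plus the number of blocks whose length is not predicted `L` blocks ahead. -/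
theorem abs_signSum_sub_predicted_le {t : ℕ → ℕ} (ht : ∀ i, t i = 1 ∨ t i = 2) (n L : ℕ) :
    |signSum (directedSeq t) n -
        ∑ m ∈ Finset.range n, letterSign (t (m + L)) * predictedBlock n L m t| ≤
      1 + 4 * L + 2 * ∑ m ∈ Finset.range n,
        (if (directedWord t m).length ≤ m + L then (1 : ℝ) else 0) := by
  have h1 := abs_signSum_sub_blocks_le ht (Nat.le_add_left n L)
  rw [Finset.sum_range_add] at h1
  simp only [add_comm L] at h1
  set u : ℕ → ℝ := fun m => if (directedWord t m).length < n then 1 else 0 with hu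
  have hu0 : ∀ m, 0 ≤ u m := fun m => by simp only [hu]; split_ifs <;> norm_num
  have hu1 : ∀ m, u m ≤ 1 := fun m => by simp only [hu]; split_ifs <;> norm_num
  set f : ℕ → ℝ := fun i => directedSeq t i * letterSign (t i) * u i with hf
  have h2 : |∑ i ∈ Finset.range L, f i| ≤ 2 * L := by
    refine (Finset.abs_sum_le_sum_abs _ _).trans
      ((Finset.sum_le_card_nsmul _ _ 2 fun i _ => ?_).trans (by simp [mul_comm]))
    have hx : (directedSeq t i : ℝ) ≤ 2 := by
      rcases directedSeq_mem ht i with h | h <;> norm_num [h]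
    rw [hf, abs_mul, abs_mul, abs_letterSign (ht _), abs_of_nonneg (hu0 i), mul_one, Nat.abs_cast]
    exact (mul_le_of_le_one_right (Nat.cast_nonneg _) (hu1 i)).trans hx
  have h3 : |∑ m ∈ Finset.range n, f (m + L) -
      ∑ m ∈ Finset.range n, letterSign (t (m + L)) * predictedBlock n L m t| ≤
      2 * ∑ m ∈ Finset.range n, (if (directedWord t m).length ≤ m + L then (1 : ℝ) else 0) +
      2 * (∑ m ∈ Finset.range n, u m - ∑ m ∈ Finset.range n, u (m + L)) := by
    rw [← Finset.sum_sub_distrib, ← Finset.sum_sub_distrib, Finset.mul_sum, Finset.mul_sum,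
      ← Finset.sum_add_distrib]
    exact (Finset.abs_sum_le_sum_abs _ _).trans
      (Finset.sum_le_sum fun m _ => abs_block_sub_predictedBlock_le ht n L m)
  -- Telescoping: only the first `L` terms, minus `L` nonnegative ones at the end, survive.
  have h4 : ∑ m ∈ Finset.range n, u m - ∑ m ∈ Finset.range n, u (m + L) ≤ L := by
    have e := (Finset.sum_range_add u L n).symm.trans
      ((congrArg (fun k => ∑ m ∈ Finset.range k, u m) (add_comm L n)).trans
        (Finset.sum_range_add u n L))
    simp only [add_comm L] at e
    have e1 : ∑ m ∈ Finset.range L, u m ≤ L :=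
      (Finset.sum_le_card_nsmul _ _ 1 fun i _ => hu1 i).trans (by simp)
    have e2 : 0 ≤ ∑ m ∈ Finset.range L, u (n + m) := Finset.sum_nonneg fun i _ => hu0 _
    linarith
  rw [abs_le] at *
  constructor <;> linarith [h1.1, h1.2, h2.1, h2.2, h3.1, h3.2]

/-! ### Growth of the words -/

/-- If the letter `2` occurs infinitely often, then the words get longer than any shift of the
number of blocks. -/
theorem eventually_lt_length_directedWord {t : ℕ → ℕ} (ht : ∀ i, t i = 1 ∨ t i = 2)
    (h2 : ∀ r, ∃ k ≥ r, t k = 2) (L : ℕ) :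
    ∀ᶠ m in atTop, m + L < (directedWord t m).length := by
  -- The excess of length over number of blocks never decreases, as each block has at least one
  -- letter.
  have hmono : ∀ L M m, M ≤ m → M + L ≤ (directedWord t M).length →
      m + L ≤ (directedWord t m).length := by
    intro L M m hm h
    induction m, hm using Nat.le_induction with
    | base => exact h
    | succ m _ ih =>
      have := length_directedWord_succ ht m
      rcases directedSeq_mem ht m with h | h <;> omega
  have key : ∀ L, ∃ M, M + L ≤ (directedWord t M).length := by
    intro L
    induction L with
    | zero => exact ⟨0, Nat.zero_le _⟩
    | succ L ih =>
      obtain ⟨M, hM⟩ := ih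
      obtain ⟨k, hk, hk2⟩ := h2 M
      have hle := le_length_directedWord t k
      -- Block `k` is filled with 2 and starts at position `(directedWord t k).length`; the block
      -- with that index therefore has length 2 and raises the excess by one.
      have hx : directedSeq t (directedWord t k).length = 2 := by
        have := directedSeq_block ht (n := k) (i := 0)
          (by rcases directedSeq_mem ht k with h | h <;> omega)
        rwa [add_zero, hk2] at this
      refine ⟨(directedWord t k).length + 1, ?_⟩
      have := hmono L M (directedWord t k).length (by omega) hM
      rw [length_directedWord_succ ht, hx]
      omega
  obtain ⟨M, hM⟩ := key (L + 1)
  filter_upwards [eventually_ge_atTop M] with m hm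
  have := hmono (L + 1) M m hm hM
  omega

/-! ### Dependence on finitely many directing letters -/

theorem directedWord_congr {t t' : ℕ → ℕ} {n : ℕ} (h : ∀ i < n, t i = t' i) :
    directedWord t n = directedWord t' n := by
  induction n with
  | zero => rfl
  | succ n ih =>
    rw [directedWord, directedWord, ih fun i hi => h i (by omega), h n (by omega)]

/-- This is what makes the prediction usable as the past factor in the correlation estimate. -/
theorem dependsOn_predictedBlock (n L m : ℕ) : DependsOn (predictedBlock n L m) (Set.Iic m) := by
  intro t t' h
  rw [predictedBlock, predictedBlock, directedWord_congr fun i hi => h i (Set.mem_Iic.2 hi.le)]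

theorem dependsOn_signSum (n : ℕ) :
    DependsOn (fun t => signSum (directedSeq t) n) (Set.Iic n) := by
  intro t t' h
  refine Finset.sum_congr rfl fun i hi => ?_
  rw [directedSeq, directedSeq,
    directedWord_congr fun j hj => h j (Set.mem_Iic.2 (by have := Finset.mem_range.1 hi; omega))]

/-! ### Expectations of functionals of the Markov chain -/

theorem measurable_of_dependsOn {Ω : Type*} [MeasurableSpace Ω] {T : ℕ → Ω → ℕ}
    (hT : ∀ n, Measurable (T n)) {f : (ℕ → ℕ) → ℝ} {m : ℕ} (hf : DependsOn f (Set.Iic m)) :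
    Measurable fun ω => f fun i => T i ω := by
  obtain ⟨g, rfl⟩ := dependsOn_iff_exists_comp.1 hf
  exact (Measurable.of_discrete (f := g)).comp (measurable_pi_lambda _ fun i => hT i)

theorem integrable_of_dependsOn {Ω : Type*} [MeasurableSpace Ω] {P : Measure Ω}
    [IsProbabilityMeasure P] {T : ℕ → Ω → ℕ} (hT : ∀ n, Measurable (T n))
    {f : (ℕ → ℕ) → ℝ} {m : ℕ} (hf : DependsOn f (Set.Iic m)) {C : ℝ}
    (hC : ∀ ω, |f fun i => T i ω| ≤ C) : Integrable (fun ω => f fun i => T i ω) P :=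
  Integrable.of_bound (measurable_of_dependsOn hT hf).aestronglyMeasurable C (ae_of_all _ hC)

namespace IsMarkovChain

variable {Ω : Type*} [MeasurableSpace Ω] {P : Measure Ω} {p : ℝ} {T : ℕ → Ω → ℕ}

theorem letter_eq {Q : ℕ → ℕ → ℝ} (hT : IsMarkovChain P {1, 2} 1 Q T) (ω : Ω) (i : ℕ) :
    T i ω = 1 ∨ T i ω = 2 := by
  simpa using hT.mem_alphabet i ω

theorem measurableSet_past {A : Set ℕ} {x₀ : ℕ} {Q : ℕ → ℕ → ℝ} (hT : IsMarkovChain P A x₀ Q T)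
    (m : ℕ) (a : ℕ → ℕ) : MeasurableSet {ω | ∀ i ≤ m, T i ω = a i} := by
  simp only [Set.ofPred_forall]
  exact MeasurableSet.iInter fun i => MeasurableSet.iInter fun _ =>
    hT.measurable i (measurableSet_singleton _)

theorem measurable_letterSign {A : Set ℕ} {x₀ : ℕ} {Q : ℕ → ℕ → ℝ}
    (hT : IsMarkovChain P A x₀ Q T) (m : ℕ) : Measurable fun ω => letterSign (T m ω) :=
  (Measurable.of_discrete (f := letterSign)).comp (hT.measurable m)

/-- The Markov property on one cylinder: a sign `s` is followed on average by `(1 - p) s - p s`. -/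
theorem setIntegral_letterSign_succ [IsProbabilityMeasure P]
    (hT : IsMarkovChain P {1, 2} 1 (flipTransition p) T) (m : ℕ) (a : ℕ → ℕ) :
    ∫ ω in {ω | ∀ i ≤ m, T i ω = a i}, letterSign (T (m + 1) ω) ∂P =
      ∫ ω in {ω | ∀ i ≤ m, T i ω = a i}, (1 - 2 * p) * letterSign (T m ω) ∂P := by
  set B := {ω | ∀ i ≤ m, T i ω = a i} with hB
  have hBm : MeasurableSet B := hT.measurableSet_past m a
  by_cases h0 : P B = 0
  · rw [setIntegral_measure_zero _ h0, setIntegral_measure_zero _ h0]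
  have hcond : ∀ b, b = 1 ∨ b = 2 → P.real (B ∩ {ω | T (m + 1) ω = b}) =
      P.real B * flipTransition p (a m) b := by
    intro b hb
    have hpos : P.real B ≠ 0 := (measureReal_ne_zero_iff (measure_ne_top _ _)).2 h0
    rw [← hT.transition m a b (by simpa using hb) h0, measureReal_def (P[|_]), cond_apply hBm,
      ENNReal.toReal_mul, ENNReal.toReal_inv, ← measureReal_def, ← measureReal_def,
      mul_inv_cancel_left₀ hpos]
  have hset : ∀ b, MeasurableSet {ω | T (m + 1) ω = b} := fun b =>
    hT.measurable (m + 1) (measurableSet_singleton b)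
  have hright : ∫ ω in B, (1 - 2 * p) * letterSign (T m ω) ∂P =
      P.real B * ((1 - 2 * p) * letterSign (a m)) := by
    rw [setIntegral_congr_fun hBm (g := fun _ => (1 - 2 * p) * letterSign (a m))
      fun ω hω => by simp only [hω m le_rfl]]
    rw [setIntegral_const, smul_eq_mul]
  have hleft : ∫ ω in B, letterSign (T (m + 1) ω) ∂P =
      P.real (B ∩ {ω | T (m + 1) ω = 1}) - P.real (B ∩ {ω | T (m + 1) ω = 2}) := by
    have e : ∀ ω, letterSign (T (m + 1) ω) =
        Set.indicator {ω | T (m + 1) ω = 1} (fun _ => (1 : ℝ)) ω -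
        Set.indicator {ω | T (m + 1) ω = 2} (fun _ => (1 : ℝ)) ω := by
      intro ω
      rcases hT.letter_eq ω (m + 1) with h | h <;> norm_num [Set.indicator, h, letterSign]
    simp_rw [e]
    rw [integral_sub ((integrable_const (1 : ℝ)).indicator (hset 1))
      ((integrable_const (1 : ℝ)).indicator (hset 2)),
      setIntegral_indicator (hset 1), setIntegral_indicator (hset 2)]
    simp
  rw [hleft, hright, hcond 1 (Or.inl rfl), hcond 2 (Or.inr rfl)]
  obtain ⟨ω, hω⟩ := nonempty_of_measure_ne_zero h0
  have ham : a m = 1 ∨ a m = 2 := hω m le_rfl ▸ hT.letter_eq ω m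
  rcases ham with h | h <;> norm_num [h, flipTransition, letterSign] <;> ring

/-- The sign of the next letter has conditional expectation `(1 - 2p)` times the present sign. -/
theorem integral_letterSign_succ_mul [IsProbabilityMeasure P]
    (hT : IsMarkovChain P {1, 2} 1 (flipTransition p) T) {f : (ℕ → ℕ) → ℝ} {m : ℕ}
    (hf : DependsOn f (Set.Iic m)) {C : ℝ} (hC : ∀ ω, |f fun i => T i ω| ≤ C) :
    ∫ ω, letterSign (T (m + 1) ω) * f (fun i => T i ω) ∂P =
      (1 - 2 * p) * ∫ ω, letterSign (T m ω) * f (fun i => T i ω) ∂P := by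
  have hint : ∀ k, Integrable (fun ω => letterSign (T k ω) * f (fun i => T i ω)) P := fun k =>
    (integrable_of_dependsOn hT.measurable hf hC).bdd_mul
      (c := 1) (hT.measurable_letterSign k).aestronglyMeasurable
      (ae_of_all _ fun ω => (abs_letterSign (hT.letter_eq ω k)).le)
  -- The countably many trajectories up to time `m` partition `Ω`, and `f` is constant on each
  -- piece; the padding value 0 plays no role.
  let ext : (Fin (m + 1) → ℕ) → ℕ → ℕ := fun a i => if h : i < m + 1 then a ⟨i, h⟩ else 0
  let B : (Fin (m + 1) → ℕ) → Set Ω := fun a => {ω | ∀ i ≤ m, T i ω = ext a i}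
  have hB : ∀ a, MeasurableSet (B a) := fun a => hT.measurableSet_past m _
  have hunion : ⋃ a, B a = Set.univ := by
    refine Set.eq_univ_of_forall fun ω => Set.mem_iUnion.2 ⟨fun i => T i ω, fun i hi => ?_⟩
    simp only [ext, dif_pos (Nat.lt_succ_of_le hi)]
  have hdisj : Pairwise (Function.onFun Disjoint B) := by
    intro a b hab
    refine Set.disjoint_left.2 fun ω ha hb => hab (funext fun i => ?_)
    have := (ha i (Nat.le_of_lt_succ i.2)).symm.trans (hb i (Nat.le_of_lt_succ i.2))
    simpa only [ext, dif_pos i.2] using this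
  rw [← integral_const_mul, ← setIntegral_univ, ← hunion,
    integral_iUnion hB hdisj (hint _).integrableOn, ← setIntegral_univ, ← hunion,
    integral_iUnion hB hdisj ((hint _).const_mul _).integrableOn]
  refine tsum_congr fun a => ?_
  have hfa : ∀ ω ∈ B a, f (fun i => T i ω) = f (ext a) := fun ω hω =>
    hf fun i hi => hω i hi
  have h1 : ∫ ω in B a, letterSign (T (m + 1) ω) * f (fun i => T i ω) ∂P =
      ∫ ω in B a, letterSign (T (m + 1) ω) * f (ext a) ∂P :=
    setIntegral_congr_fun (hB a) fun ω hω => by simp only [hfa ω hω]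
  have h2 : ∫ ω in B a, (1 - 2 * p) * (letterSign (T m ω) * f (fun i => T i ω)) ∂P =
      ∫ ω in B a, (1 - 2 * p) * letterSign (T m ω) * f (ext a) ∂P :=
    setIntegral_congr_fun (hB a) fun ω hω => by simp only [hfa ω hω, mul_assoc]
  rw [h1, h2, integral_mul_const, integral_mul_const, hT.setIntegral_letterSign_succ m]

/-- The correlation of the sign with the past decays geometrically. -/
theorem integral_letterSign_add_mul [IsProbabilityMeasure P]
    (hT : IsMarkovChain P {1, 2} 1 (flipTransition p) T) {f : (ℕ → ℕ) → ℝ} {m : ℕ}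
    (hf : DependsOn f (Set.Iic m)) {C : ℝ} (hC : ∀ ω, |f fun i => T i ω| ≤ C) (L : ℕ) :
    ∫ ω, letterSign (T (m + L) ω) * f (fun i => T i ω) ∂P =
      (1 - 2 * p) ^ L * ∫ ω, letterSign (T m ω) * f (fun i => T i ω) ∂P := by
  induction L with
  | zero => simp
  | succ L ih =>
    rw [← add_assoc, hT.integral_letterSign_succ_mul
      (hf.mono (Set.Iic_subset_Iic.2 (Nat.le_add_right m L))) hC, ih, pow_succ']
    ring

theorem abs_integral_letterSign_add_mul_le [IsProbabilityMeasure P]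
    (hT : IsMarkovChain P {1, 2} 1 (flipTransition p) T) {f : (ℕ → ℕ) → ℝ} {m : ℕ}
    (hf : DependsOn f (Set.Iic m)) {C : ℝ} (hC : ∀ ω, |f fun i => T i ω| ≤ C) (L : ℕ) :
    |∫ ω, letterSign (T (m + L) ω) * f (fun i => T i ω) ∂P| ≤ |1 - 2 * p| ^ L * C := by
  rw [hT.integral_letterSign_add_mul hf hC, abs_mul, abs_pow]
  refine mul_le_mul_of_nonneg_left ?_ (by positivity)
  have h := norm_integral_le_of_norm_le_const (μ := P) (C := C)
    (f := fun ω => letterSign (T m ω) * f (fun i => T i ω)) (ae_of_all _ fun ω => by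
      rw [Real.norm_eq_abs, abs_mul, abs_letterSign (hT.letter_eq ω m), one_mul]
      exact hC ω)
  simpa using h

/-- The probability of a run of ones starting at index `r` decreases geometrically. -/
theorem integral_run_of_ones [IsProbabilityMeasure P]
    (hT : IsMarkovChain P {1, 2} 1 (flipTransition p) T) (r s : ℕ) :
    ∫ ω, ∏ i ∈ Finset.range (s + 1), (1 + letterSign (T (r + i) ω)) / 2 ∂P =
      (1 - p) ^ s * ∫ ω, (1 + letterSign (T r ω)) / 2 ∂P := by
  induction s with
  | zero => simp
  | succ s ih =>
    let f : (ℕ → ℕ) → ℝ := fun t => ∏ i ∈ Finset.range (s + 1), (1 + letterSign (t (r + i))) / 2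
    have hf : DependsOn f (Set.Iic (r + s)) := fun t t' h =>
      Finset.prod_congr rfl fun i hi => by
        rw [h (r + i) (Set.mem_Iic.2 (by have := Finset.mem_range.1 hi; omega))]
    have hC : ∀ ω, |f fun i => T i ω| ≤ 1 := fun ω => by
      rw [Finset.abs_prod]
      refine Finset.prod_le_one (fun _ _ => abs_nonneg _) fun i _ => ?_
      rcases hT.letter_eq ω (r + i) with h | h <;> norm_num [h, letterSign]
    -- `f` indicates a run of ones, so the last sign is 1 wherever `f` is nonzero. One more factor
    -- thus multiplies the integral by `(1 + (1 - 2p)) / 2 = 1 - p`.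
    have hsign : ∀ ω, letterSign (T (r + s) ω) * f (fun i => T i ω) = f fun i => T i ω := by
      intro ω
      simp only [f, Finset.prod_range_succ]
      rcases hT.letter_eq ω (r + s) with h | h <;> norm_num [h, letterSign]
    have hint := integrable_of_dependsOn (P := P) hT.measurable hf hC
    have hint' : Integrable (fun ω => letterSign (T (r + s + 1) ω) * f (fun i => T i ω)) P :=
      hint.bdd_mul (c := 1) (hT.measurable_letterSign _).aestronglyMeasurable
        (ae_of_all _ fun ω => (abs_letterSign (hT.letter_eq ω _)).le)
    have hstep := hT.integral_letterSign_succ_mul hf hC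
    simp_rw [hsign] at hstep
    have e : ∀ ω, ∏ i ∈ Finset.range (s + 1 + 1), (1 + letterSign (T (r + i) ω)) / 2 =
        (f (fun i => T i ω) + letterSign (T (r + s + 1) ω) * f (fun i => T i ω)) / 2 := by
      intro ω
      rw [Finset.prod_range_succ, add_assoc r s 1]
      ring
    simp_rw [e]
    rw [integral_div, integral_add hint hint', hstep, ih, pow_succ]
    ring

/-- Almost surely, the letter `2` occurs infinitely often in the chain. -/
theorem ae_exists_two [IsProbabilityMeasure P] (hp0 : 0 < p) (hp1 : p < 1)
    (hT : IsMarkovChain P {1, 2} 1 (flipTransition p) T) :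
    ∀ᵐ ω ∂P, ∀ r, ∃ k ≥ r, T k ω = 2 := by
  refine ae_all_iff.2 fun r => ?_
  have hBm : MeasurableSet {ω | ∀ i, r ≤ i → T i ω = 1} := by
    simp only [Set.ofPred_forall]
    exact MeasurableSet.iInter fun i => MeasurableSet.iInter fun _ =>
      hT.measurable i (measurableSet_singleton _)
  set B := {ω | ∀ i, r ≤ i → T i ω = 1} with hB
  have hle : ∀ s, P.real B ≤ (1 - p) ^ s * ∫ ω, (1 + letterSign (T r ω)) / 2 ∂P := by
    intro s
    rw [← hT.integral_run_of_ones r s, ← integral_indicator_one hBm]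
    have hfac : ∀ ω i, 0 ≤ (1 + letterSign (T i ω)) / 2 ∧ (1 + letterSign (T i ω)) / 2 ≤ 1 :=
      fun ω i => by rcases hT.letter_eq ω i with h | h <;> norm_num [h, letterSign]
    refine integral_mono ((integrable_const (1 : ℝ)).indicator hBm)
      (Integrable.of_bound (C := 1) ?_ (ae_of_all _ fun ω => ?_)) fun ω => ?_
    · exact (Finset.measurable_fun_prod _ fun i _ =>
        ((hT.measurable_letterSign (r + i)).const_add 1).div_const 2).aestronglyMeasurable
    · rw [Real.norm_eq_abs, Finset.abs_prod]
      exact Finset.prod_le_one (fun _ _ => abs_nonneg _) fun i _ => by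
        rw [abs_of_nonneg (hfac ω _).1]; exact (hfac ω _).2
    · by_cases hω : ω ∈ B
      · rw [Set.indicator_of_mem hω]
        refine (Finset.prod_eq_one fun i _ => ?_).ge
        norm_num [hω (r + i) (Nat.le_add_right r i), letterSign]
      · rw [Set.indicator_of_notMem hω]
        exact Finset.prod_nonneg fun i _ => (hfac ω _).1
  have hlim := (tendsto_pow_atTop_nhds_zero_of_lt_one (by linarith : 0 ≤ 1 - p)
    (by linarith)).mul_const (∫ ω, (1 + letterSign (T r ω)) / 2 ∂P)
  rw [zero_mul] at hlim
  have h0 : P.real B = 0 := le_antisymm (ge_of_tendsto' hlim hle) measureReal_nonneg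
  have hae : ∀ᵐ ω ∂P, ω ∉ B :=
    measure_eq_zero_iff_ae_notMem.1 ((measureReal_eq_zero_iff (measure_ne_top _ _)).1 h0)
  filter_upwards [hae] with ω hω
  by_contra! hcon
  exact hω fun i hi => (hT.letter_eq ω i).resolve_right (hcon i hi)

/-- The probability that the first `m` blocks do not reach beyond position `m + L` tends to `0`. -/
theorem tendsto_integral_length_le [IsProbabilityMeasure P] (hp0 : 0 < p) (hp1 : p < 1)
    (hT : IsMarkovChain P {1, 2} 1 (flipTransition p) T) (L : ℕ) :
    Tendsto (fun m : ℕ => ∫ ω,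
      (if (directedWord (fun i => T i ω) m).length ≤ m + L then (1 : ℝ) else 0) ∂P)
      atTop (𝓝 0) := by
  suffices h : Tendsto (fun m : ℕ => ∫ ω,
      (if (directedWord (fun i => T i ω) m).length ≤ m + L then (1 : ℝ) else 0) ∂P)
      atTop (𝓝 (∫ _, (0 : ℝ) ∂P)) by rwa [integral_zero] at h
  refine tendsto_integral_of_dominated_convergence (fun _ => 1) (fun m => ?_)
    (integrable_const _) (fun m => ae_of_all _ fun ω => ?_) ?_
  · have hf : DependsOn (fun t => if (directedWord t m).length ≤ m + L then (1 : ℝ) else 0)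
        (Set.Iic m) := fun t t' h => by
      simp only [directedWord_congr fun i hi => h i (Set.mem_Iic.2 hi.le)]
    exact (measurable_of_dependsOn hT.measurable hf).aestronglyMeasurable
  · split_ifs <;> norm_num
  · filter_upwards [hT.ae_exists_two hp0 hp1] with ω hω
    refine tendsto_const_nhds.congr' ?_
    filter_upwards [eventually_lt_length_directedWord (hT.letter_eq ω) hω L] with m hm
    rw [if_neg (not_le.2 hm)]

/-! ### The expected signed count is `o(n)` -/

theorem integrable_signSum [IsProbabilityMeasure P] {Q : ℕ → ℕ → ℝ}
    (hT : IsMarkovChain P {1, 2} 1 Q T) (n : ℕ) :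
    Integrable (fun ω => signSum (directedSeq fun i => T i ω) n) P :=
  integrable_of_dependsOn hT.measurable (dependsOn_signSum n) (C := n) fun ω => by
    simpa [signSum] using abs_signSum_sub_le (directedSeq_mem (hT.letter_eq ω)) 0 n

/-- The expected signed count up to `n` is bounded by a constant, the expected number of
unpredicted blocks, and the decay of correlations over `L` blocks. -/
theorem abs_integral_signSum_le [IsProbabilityMeasure P]
    (hT : IsMarkovChain P {1, 2} 1 (flipTransition p) T) (L n : ℕ) :
    |∫ ω, signSum (directedSeq fun i => T i ω) n ∂P| ≤
      1 + 4 * L + 2 * ∑ m ∈ Finset.range n, ∫ ω,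
        (if (directedWord (fun i => T i ω) m).length ≤ m + L then (1 : ℝ) else 0) ∂P +
      n * (|1 - 2 * p| ^ L * 2) := by
  have hS := hT.integrable_signSum n
  have hb : ∀ m ω, |predictedBlock n L m fun i => T i ω| ≤ 2 := fun m ω =>
    abs_predictedBlock_le (hT.letter_eq ω) n L m
  have hH : ∀ m, Integrable
      (fun ω => letterSign (T (m + L) ω) * predictedBlock n L m fun i => T i ω) P := fun m =>
    (integrable_of_dependsOn hT.measurable (dependsOn_predictedBlock n L m) (hb m)).bdd_mul
      (c := 1) (hT.measurable_letterSign _).aestronglyMeasurable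
      (ae_of_all _ fun ω => (abs_letterSign (hT.letter_eq ω _)).le)
  have hI : ∀ m, Integrable (fun ω =>
      (if (directedWord (fun i => T i ω) m).length ≤ m + L then (1 : ℝ) else 0)) P := fun m =>
    integrable_of_dependsOn (m := m) (C := 1)
      (f := fun t => if (directedWord t m).length ≤ m + L then (1 : ℝ) else 0) hT.measurable
      (fun t t' h => by simp only [directedWord_congr fun i hi => h i (Set.mem_Iic.2 hi.le)])
      fun ω => by split_ifs <;> norm_num
  have hHs := integrable_finsetSum (Finset.range n) fun m _ => hH m
  have hIs := (integrable_finsetSum (Finset.range n) fun m _ => hI m).const_mul 2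
  have h1 : |∫ ω, signSum (directedSeq fun i => T i ω) n ∂P -
      ∫ ω, ∑ m ∈ Finset.range n,
        letterSign (T (m + L) ω) * predictedBlock n L m (fun i => T i ω) ∂P| ≤
      1 + 4 * L + 2 * ∑ m ∈ Finset.range n, ∫ ω,
        (if (directedWord (fun i => T i ω) m).length ≤ m + L then (1 : ℝ) else 0) ∂P := by
    rw [← integral_sub hS hHs]
    refine (abs_integral_le_integral_abs).trans ((integral_mono (hS.sub hHs).abs
      ((integrable_const (1 + 4 * (L : ℝ))).add hIs) fun ω =>
        abs_signSum_sub_predicted_le (hT.letter_eq ω) n L).trans_eq ?_)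
    rw [integral_add' (integrable_const _) hIs, integral_const_mul,
      integral_finsetSum _ fun m _ => hI m]
    simp
  have h2 : |∫ ω, ∑ m ∈ Finset.range n,
      letterSign (T (m + L) ω) * predictedBlock n L m (fun i => T i ω) ∂P| ≤
      n * (|1 - 2 * p| ^ L * 2) := by
    rw [integral_finsetSum _ fun m _ => hH m]
    refine (Finset.abs_sum_le_sum_abs _ _).trans ((Finset.sum_le_card_nsmul _ _ _ fun m _ =>
      hT.abs_integral_letterSign_add_mul_le (dependsOn_predictedBlock n L m) (hb m) L).trans ?_)
    simp
  rw [abs_le] at *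
  constructor <;> linarith [h1.1, h1.2, h2.1, h2.2]

theorem tendsto_integral_signSum_div [IsProbabilityMeasure P] (hp0 : 0 < p) (hp1 : p < 1)
    (hT : IsMarkovChain P {1, 2} 1 (flipTransition p) T) :
    Tendsto (fun n : ℕ => (∫ ω, signSum (directedSeq fun i => T i ω) n ∂P) / (n : ℝ))
      atTop (𝓝 0) := by
  rw [tendsto_zero_iff_abs_tendsto_zero, Metric.tendsto_atTop']
  intro ε hε
  have hq : |1 - 2 * p| < 1 := abs_lt.2 ⟨by linarith, by linarith⟩
  -- `L` is fixed before `n`: the correlation term `2|1 - 2p|^L` takes less than `ε / 2`, and the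
  -- rest vanishes by Cesàro averaging.
  obtain ⟨L, hL⟩ := exists_pow_lt_of_lt_one (by linarith : 0 < ε / 4) hq
  have hlim : Tendsto (fun n : ℕ => (1 + 4 * (L : ℝ)) / n + 2 * ((n : ℝ)⁻¹ *
      ∑ m ∈ Finset.range n, ∫ ω,
        (if (directedWord (fun i => T i ω) m).length ≤ m + L then (1 : ℝ) else 0) ∂P))
      atTop (𝓝 (0 + 2 * 0)) :=
    (tendsto_const_div_atTop_nhds_zero_nat _).add
      ((hT.tendsto_integral_length_le hp0 hp1 L).cesaro.const_mul 2)
  obtain ⟨N, hN⟩ := eventually_atTop.1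
    (hlim.eventually_lt_const (by linarith : 0 + 2 * 0 < ε / 2))
  refine ⟨N, fun n hn => ?_⟩
  have hn0 : (0 : ℝ) < n := by exact_mod_cast (Nat.zero_le N).trans_lt hn
  have h := hN n hn.le
  have hb := div_le_div_of_nonneg_right (hT.abs_integral_signSum_le L n) hn0.le
  rw [Function.comp_apply, Real.dist_0_eq_abs, abs_abs, abs_div, Nat.abs_cast]
  rw [add_div, add_div, mul_div_cancel_left₀ _ hn0.ne', mul_div_assoc,
    div_eq_inv_mul (Finset.sum _ _)] at hb
  linarith

end IsMarkovChain

theorem mainTheorem5 {Ω : Type*} [MeasurableSpace Ω] (P : Measure Ω) [IsProbabilityMeasure P]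
    (p : ℝ) (hp0 : 0 < p) (hp1 : p < 1) (T : ℕ → Ω → ℕ)
    (hT : IsMarkovChain P {1, 2} 1 (flipTransition p) T) :
    Tendsto (fun n : ℕ =>
        (∫ ω, (letterCount 1 (directedSeq (fun i => T i ω)) n : ℝ) ∂P) / (n : ℝ))
      atTop (𝓝 (1 / 2)) := by
  have h := ((hT.tendsto_integral_signSum_div hp0 hp1).const_add 1).div_const 2
  rw [add_zero] at h
  refine h.congr' ?_
  filter_upwards [eventually_gt_atTop 0] with n hn
  have hn0 : (n : ℝ) ≠ 0 := by exact_mod_cast hn.ne'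
  simp_rw [fun ω => letterCount_one_eq (directedSeq_mem (hT.letter_eq ω)) n]
  rw [integral_div, integral_add (integrable_const _) (hT.integrable_signSum n)]
  simp only [integral_const, probReal_univ, one_smul]
  field_simp
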